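/- Let $f:\mathbb{R}^n\times\mathbb{R}^m\to\mathbb{R}^n$ be continuously differentiable and $g:\mathbb{R}^n\times\mathbb{R}^m\to\mathbb{R}^m$ twice continuously differentiable, with $f(0,0)=0$ and $g(0,0)=0$, and consider the time-invariant differential-algebraic system $$\dot w=f(w,z),\qquad 0=g(w,z),$$ whose solutions are the continuously differentiable functions $(w,z)$ on an interval $[t_0,\infty)$ that satisfy both equations there. Let $W\subseteq\mathbb{R}^n$, $Z\subseteq\mathbb{R}^m$ with $(0,0)\in W\times Z$, and put $\mathcal{C}=\{(w,z)\in W\times Z: g(w,z)=0\}$. Assume that the system evolves within $W\times Z$, that is, from every point of $\mathcal{C}$ there starts a solution on $[0,\infty)$ that remains in $W\times Z$; that $\frac{\partial g}{\partial z}$ is invertible on $W\times Z$; and that $\left[\frac{\partial g}{\partial z}\right]^{-1}\frac{\partial g}{\partial w}$ is bounded on $W\times Z$. Let $p,q\in[1,\infty]$, write $\|\cdot\|_p$ for the $p$-norm (and the induced matrix norm), and let $\mu_q(A)=\lim_{h\to0^+}\frac{\|I+hA\|_q-1}{h}$. Suppose that there are a matrix function $M(w,z)\in\mathbb{R}^{n\times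 n}$, differentiable and invertible at every point of $\mathcal{C}$, and a constant $\beta>0$ such that $\mu_q(J_M(w,z))\le-\beta$ for all $(w,z)\in\mathcal{C}$, where $$J_M=\dot M M^{-1}+M\Big(\frac{\partial f}{\partial w}-\frac{\partial f}{\partial z}\Big[\frac{\partial g}{\partial z}\Big]^{-1}\frac{\partial g}{\partial w}\Big)M^{-1}$$ and $\dot M$ is the derivative of $M$ along solutions, i.e. in the direction $(\dot w,\dot z)=\big(f,-\big[\frac{\partial g}{\partial z}\big]^{-1}\frac{\partial g}{\partial w}f\big)$. Then: 1. The system is locally exponentially stable at the origin: there are $\delta,c,\alpha>0$ such that, for every $t_0$, every solution $x=(w,z)$ on $[t_0,\infty)$ with $\|x(t_0)\|_p<\delta$ satisfies $\|x(t)\|_p\le c\,e^{-\alpha(t-t_0)}\|x(t_0)\|_p$ for all $t\ge t_0$. 2. If moreover $W$ is convex, for every $w\in W$ there is a unique $z=z_0(w)\in Z$ with $g(w,z)=0$ and $z_0$ is continuous on $W$, and $\|M\|_q$ and $\|M^{-1}\|_q$ are bounded on $\mathcal{C}$, then the system is contracting in $W\times Z$: there are $c,\alpha>0$ such that, for every $t_0$,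 any two solutions $x_1,x_2$ on $[t_0,\infty)$ that start in $W\times Z$ satisfy $\|x_1(t)-x_2(t)\|_p\le c\,e^{-\alpha(t-t_0)}\|x_1(t_0)-x_2(t_0)\|_p$ for all $t\ge t_0$; and it is exponentially stable in $W\times Z$: there are $c,\alpha>0$ such that every solution $x$ on $[t_0,\infty)$ that starts in $W\times Z$ satisfies $\|x(t)\|_p\le c\,e^{-\alpha(t-t_0)}\|x(t_0)\|_p$ for all $t\ge t_0$. -/

import Mathlib

open scoped ENNReal Topology

noncomputable section

namespace DAE

/-- The space of pairs `(w, z)` with `w ∈ ℝⁿ` and `z ∈ ℝᵐ`. Only its topology and its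
differentiable structure are used; sizes of vectors are measured by `pnorm`. -/
abbrev State (n m : ℕ) : Type := (Fin n → ℝ) × (Fin m → ℝ)

/-- The `p`-norm of the stacked vector `[w; z] ∈ ℝⁿ⁺ᵐ`. -/
def pnorm (p : ℝ≥0∞) [Fact (1 ≤ p)] {n m : ℕ} (x : State n m) : ℝ :=
  ‖(WithLp.toLp p (Sum.elim x.1 x.2) : PiLp p (fun _ : Fin n ⊕ Fin m => ℝ))‖

/-- The matrix norm induced by the vector `p`-norms. -/
def inducedNorm (p : ℝ≥0∞) [Fact (1 ≤ p)] {k l : ℕ} (A : Matrix (Fin k) (Fin l) ℝ) : ℝ :=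
  ‖LinearMap.toContinuousLinearMap (Matrix.toLpLin p p A)‖

/-- The matrix measure (logarithmic norm) `μ_q(A) = lim_{h → 0⁺} (‖I + h A‖_q - 1) / h`. -/
def matrixMeasure (q : ℝ≥0∞) [Fact (1 ≤ q)] {n : ℕ} (A : Matrix (Fin n) (Fin n) ℝ) : ℝ :=
  Filter.limUnder (𝓝[>] (0 : ℝ)) (fun h : ℝ => (inducedNorm q (1 + h • A) - 1) / h)

/-- In a normed space, `(‖I + h B‖ - 1) / h` has a limit as `h → 0⁺` whenever `‖I‖ = 1`. -/
theorem exists_tendsto_norm_slope {E : Type*} [NormedAddCommGroup E] [NormedSpace ℝ E] (I B : E)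
    (hI : ‖I‖ = 1) :
    ∃ l : ℝ, Filter.Tendsto (fun h : ℝ => (‖I + h • B‖ - 1) / h) (𝓝[>] (0 : ℝ)) (𝓝 l) := by
  have hmono : MonotoneOn (fun h : ℝ => (‖I + h • B‖ - 1) / h) (Set.Ioi 0) := by
    intro a ha b hb hab
    have ha' : 0 < a := ha
    have hb' : 0 < b := hb
    have hab' : 0 ≤ 1 - a / b := by
      rw [sub_nonneg, div_le_one hb']
      exact hab
    have key : ‖I + a • B‖ ≤ (1 - a / b) * 1 + (a / b) * ‖I + b • B‖ := by
      have e : I + a • B = (1 - a / b) • I + (a / b) • (I + b • B) := by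
        rw [smul_add, smul_smul, div_mul_cancel₀ _ hb'.ne', sub_smul, one_smul]
        abel
      calc ‖I + a • B‖ = ‖(1 - a / b) • I + (a / b) • (I + b • B)‖ := by rw [← e]
        _ ≤ ‖(1 - a / b) • I‖ + ‖(a / b) • (I + b • B)‖ := norm_add_le _ _
        _ = (1 - a / b) * 1 + (a / b) * ‖I + b • B‖ := by
          rw [norm_smul, norm_smul, hI, Real.norm_of_nonneg hab',
            Real.norm_of_nonneg (div_pos ha' hb').le]
    change (‖I + a • B‖ - 1) / a ≤ (‖I + b • B‖ - 1) / b
    rw [div_le_iff₀ ha']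
    calc ‖I + a • B‖ - 1 ≤ (1 - a / b) * 1 + (a / b) * ‖I + b • B‖ - 1 := by linarith
      _ = (‖I + b • B‖ - 1) / b * a := by
        field_simp
        ring
  have hbdd : BddBelow ((fun h : ℝ => (‖I + h • B‖ - 1) / h) '' Set.Ioi 0) := by
    refine ⟨-‖B‖, ?_⟩
    rintro _ ⟨h, hh, rfl⟩
    have hh' : 0 < h := hh
    change -‖B‖ ≤ (‖I + h • B‖ - 1) / h
    rw [le_div_iff₀ hh']
    have h1 : ‖I‖ ≤ ‖I + h • B‖ + ‖h • B‖ := by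
      have := norm_sub_le (I + h • B) (h • B)
      simpa using this
    rw [norm_smul, Real.norm_of_nonneg hh'.le, hI] at h1
    linarith
  exact ⟨_, hmono.tendsto_nhdsGT hbdd⟩

/-- The limit that defines the matrix measure exists (for matrices of positive size). -/
theorem tendsto_matrixMeasure (q : ℝ≥0∞) [Fact (1 ≤ q)] {n : ℕ} (hn : 0 < n)
    (A : Matrix (Fin n) (Fin n) ℝ) :
    Filter.Tendsto (fun h : ℝ => (inducedNorm q (1 + h • A) - 1) / h) (𝓝[>] (0 : ℝ))
      (𝓝 (matrixMeasure q A)) := by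
  have : Nonempty (Fin n) := ⟨⟨0, hn⟩⟩
  have hmap : ∀ h : ℝ, LinearMap.toContinuousLinearMap (Matrix.toLpLin q q (1 + h • A)) =
      ContinuousLinearMap.id ℝ (PiLp q (fun _ : Fin n => ℝ)) +
        h • LinearMap.toContinuousLinearMap (Matrix.toLpLin q q A) := by
    intro h
    ext x
    simp
  obtain ⟨l, hl⟩ := exists_tendsto_norm_slope
    (ContinuousLinearMap.id ℝ (PiLp q (fun _ : Fin n => ℝ)))
    (LinearMap.toContinuousLinearMap (Matrix.toLpLin q q A)) ContinuousLinearMap.norm_id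
  refine tendsto_nhds_limUnder ⟨l, hl.congr fun h => ?_⟩
  simp only [inducedNorm, hmap h]

variable {n m : ℕ}

/-- The partial Jacobian matrix `∂F/∂w` at `x = (w, z)`. -/
def partialW {k : ℕ} (F : State n m → Fin k → ℝ) (x : State n m) : Matrix (Fin k) (Fin n) ℝ :=
  LinearMap.toMatrix' (fderiv ℝ (fun w : Fin n → ℝ => F (w, x.2)) x.1).toLinearMap

/-- The partial Jacobian matrix `∂F/∂z` at `x = (w, z)`. -/
def partialZ {k : ℕ} (F : State n m → Fin k → ℝ) (x : State n m) : Matrix (Fin k) (Fin m) ℝ :=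
  LinearMap.toMatrix' (fderiv ℝ (fun z : Fin m → ℝ => F (x.1, z)) x.2).toLinearMap

/-- `[∂g/∂z]⁻¹ ∂g/∂w`. -/
def algSlope (g : State n m → Fin m → ℝ) (x : State n m) : Matrix (Fin m) (Fin n) ℝ :=
  (partialZ g x)⁻¹ * partialW g x

/-- The matrix `∂f/∂w - ∂f/∂z [∂g/∂z]⁻¹ ∂g/∂w` of the reduced variational system. -/
def reducedMatrix (f : State n m → Fin n → ℝ) (g : State n m → Fin m → ℝ) (x : State n m) :
    Matrix (Fin n) (Fin n) ℝ :=
  partialW f x - partialZ f x * algSlope g x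

/-- The velocity `(ẇ, ż) = (f, -[∂g/∂z]⁻¹ ∂g/∂w f)` of the solution that passes through `x`;
the second component comes from differentiating the constraint `g = 0` in time. -/
def velocity (f : State n m → Fin n → ℝ) (g : State n m → Fin m → ℝ) (x : State n m) :
    State n m :=
  (f x, -(Matrix.mulVec (algSlope g x) (f x)))

/-- `Ṁ`, the derivative of the entries of `M(w, z)` along the solution that passes through `x`. -/
def matrixDot (f : State n m → Fin n → ℝ) (g : State n m → Fin m → ℝ)
    (M : State n m → Matrix (Fin n) (Fin n) ℝ) (x : State n m) : Matrix (Fin n) (Fin n) ℝ :=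
  Matrix.of fun i j => fderiv ℝ (fun y => M y i j) x (velocity f g x)

/-- `J_M = Ṁ M⁻¹ + M (∂f/∂w - ∂f/∂z [∂g/∂z]⁻¹ ∂g/∂w) M⁻¹`. -/
def JM (f : State n m → Fin n → ℝ) (g : State n m → Fin m → ℝ)
    (M : State n m → Matrix (Fin n) (Fin n) ℝ) (x : State n m) : Matrix (Fin n) (Fin n) ℝ :=
  matrixDot f g M x * (M x)⁻¹ + M x * reducedMatrix f g x * (M x)⁻¹

/-- `x = (w, z)` is a continuously differentiable solution on `[t₀, ∞)` of
`ẇ = f(w, z)`, `0 = g(w, z)`. -/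
structure IsSolution (f : State n m → Fin n → ℝ) (g : State n m → Fin m → ℝ) (t₀ : ℝ)
    (x : ℝ → State n m) : Prop where
  contDiffOn : ContDiffOn ℝ 1 x (Set.Ici t₀)
  hasDerivWithinAt : ∀ t ∈ Set.Ici t₀,
    HasDerivWithinAt (fun s => (x s).1) (f (x t)) (Set.Ici t₀) t
  constraint : ∀ t ∈ Set.Ici t₀, g (x t) = 0

/-- The points of `S` that satisfy the algebraic constraint (the admissible initial values). -/
def consistentSet (g : State n m → Fin m → ℝ) (S : Set (State n m)) : Set (State n m) :=
  {x | x ∈ S ∧ g x = 0}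

/-- The system evolves within `S`: from each admissible initial value in `S` there starts a
solution that exists for all future times and stays in `S`. -/
def EvolvesWithin (f : State n m → Fin n → ℝ) (g : State n m → Fin m → ℝ)
    (S : Set (State n m)) : Prop :=
  ∀ x₀ ∈ consistentSet g S, ∃ x : ℝ → State n m,
    IsSolution f g 0 x ∧ x 0 = x₀ ∧ ∀ t : ℝ, 0 ≤ t → x t ∈ S

/-- For every `w ∈ W` the constraint has a unique solution `z = z₀(w)` in `Z`, and `z₀` is
continuous on `W`. -/
def UniquelySolvable (g : State n m → Fin m → ℝ) (W : Set (Fin n → ℝ)) (Z : Set (Fin m → ℝ)) :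
    Prop :=
  ∃ z₀ : (Fin n → ℝ) → (Fin m → ℝ), ContinuousOn z₀ W ∧
    ∀ w ∈ W, ∀ z, (z ∈ Z ∧ g (w, z) = 0) ↔ z = z₀ w

/-- Contraction in `S`, in the `p`-norm: any two solutions that start in `S` approach each other
exponentially, with constants that do not depend on the solutions. -/
def ContractingOn (p : ℝ≥0∞) [Fact (1 ≤ p)] (f : State n m → Fin n → ℝ)
    (g : State n m → Fin m → ℝ) (S : Set (State n m)) : Prop :=
  ∃ c : ℝ, 0 < c ∧ ∃ α : ℝ, 0 < α ∧ ∀ (t₀ : ℝ) (x₁ x₂ : ℝ → State n m),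
    IsSolution f g t₀ x₁ → IsSolution f g t₀ x₂ → x₁ t₀ ∈ S → x₂ t₀ ∈ S →
    ∀ t : ℝ, t₀ ≤ t →
      pnorm p (x₁ t - x₂ t) ≤ c * Real.exp (-α * (t - t₀)) * pnorm p (x₁ t₀ - x₂ t₀)

/-- Exponential stability of the origin with region `S`: all solutions that start in `S` decay
exponentially. -/
def ExpStableOn (p : ℝ≥0∞) [Fact (1 ≤ p)] (f : State n m → Fin n → ℝ)
    (g : State n m → Fin m → ℝ) (S : Set (State n m)) : Prop :=
  ∃ c : ℝ, 0 < c ∧ ∃ α : ℝ, 0 < α ∧ ∀ (t₀ : ℝ) (x : ℝ → State n m),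
    IsSolution f g t₀ x → x t₀ ∈ S →
    ∀ t : ℝ, t₀ ≤ t → pnorm p (x t) ≤ c * Real.exp (-α * (t - t₀)) * pnorm p (x t₀)

/-- Local exponential stability of the origin: exponential stability with some ball around the
origin as region. -/
def LocallyExpStable (p : ℝ≥0∞) [Fact (1 ≤ p)] (f : State n m → Fin n → ℝ)
    (g : State n m → Fin m → ℝ) : Prop :=
  ∃ δ : ℝ, 0 < δ ∧ ExpStableOn p f g {x | pnorm p x < δ}

end DAE

end

/-!
Two solutions of the differential-algebraic system are compared through their `w`-components only.
Near a constraint point where `∂g/∂z` is invertible, strict differentiability of `g` shows that any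
two constraint points satisfy `Δz = -[∂g/∂z]⁻¹ ∂g/∂w Δw + o(Δw)`
(`DAE.eventually_norm_snd_add_le`), hence `f` changes by `A Δw + o(Δw)`, where
`A = ∂f/∂w - ∂f/∂z [∂g/∂z]⁻¹ ∂g/∂w`. Over a compact set of reference points these estimates hold
with uniform constants (`DAE.exists_hasTube_of_isCompact`). Neither an implicit function nor the
differentiability of the flow with respect to initial values is needed.

Let `x` be a solution inside the region and `y` a second solution that starts near it. The weighted
difference `v = M(x) (w_y - w_x)` satisfies `v' = J_M(x) v + o(v)`, so the upper right Dini
derivative of `‖v‖_q` is at most `(μ_q(J_M) + β / 2) ‖v‖_q ≤ -(β / 2) ‖v‖_q` as long as `y` stays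
close to `x`, and Grönwall's inequality gives exponential decay (`DAE.norm_mulVec_sub_le_exp`).
By the decay, `y` never leaves the neighbourhood (`DAE.mem_tube_and_norm_sub_le_exp`).

With the equilibrium as reference solution the neighbourhood does not depend on time, which is local
exponential stability. For contraction, let `X_s` be the solution that starts above the point with
parameter `s` of the segment that joins the initial `w`-values; `X_0` and `X_1` are the given
solutions, because the estimate also yields uniqueness. For each fixed time, the `w`-component of
`X_s` is Lipschitz near every `s` with the decaying constant, hence on all of `[0, 1]`
(`DAE.norm_sub_le_of_eventually_lipschitz`). The same principle along segments bounds the difference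
of the `z`-components. Stability is contraction towards the zero solution.

Outside the `p`- and `q`-norms, `‖·‖` is the sup norm on vectors and pairs, and the induced operator
norm on matrices; equivalence of norms only affects the constants.
-/

namespace DAE

open Set Filter Matrix
open scoped Matrix.Norms.Operator

variable {n m : ℕ}

/-! ### Norms -/

theorem exists_norm_toLp_equiv (p : ℝ≥0∞) [Fact (1 ≤ p)] (ι : Type*) [Fintype ι] :
    ∃ C : ℝ, 1 ≤ C ∧ ∀ v : ι → ℝ,
      ‖(WithLp.toLp p v : PiLp p fun _ : ι => ℝ)‖ ≤ C * ‖v‖ ∧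
        ‖v‖ ≤ C * ‖(WithLp.toLp p v : PiLp p fun _ : ι => ℝ)‖ := by
  let e := PiLp.continuousLinearEquiv p ℝ (fun _ : ι => ℝ)
  refine ⟨max 1 (max ‖e.symm.toContinuousLinearMap‖ ‖e.toContinuousLinearMap‖), le_max_left _ _,
    fun v => ⟨?_, ?_⟩⟩
  · exact (e.symm.toContinuousLinearMap.le_opNorm v).trans (mul_le_mul_of_nonneg_right
      ((le_max_left _ _).trans (le_max_right _ _)) (norm_nonneg _))
  · exact (e.toContinuousLinearMap.le_opNorm (WithLp.toLp p v)).trans (mul_le_mul_of_nonneg_right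
      ((le_max_right _ _).trans (le_max_right _ _)) (norm_nonneg _))

theorem norm_toLp_mulVec_le (p : ℝ≥0∞) [Fact (1 ≤ p)] {k l : ℕ}
    (A : Matrix (Fin k) (Fin l) ℝ) (v : Fin l → ℝ) :
    ‖(WithLp.toLp p (A *ᵥ v) : PiLp p fun _ : Fin k => ℝ)‖ ≤
      inducedNorm p A * ‖(WithLp.toLp p v : PiLp p fun _ : Fin l => ℝ)‖ :=
  (LinearMap.toContinuousLinearMap (Matrix.toLpLin p p A)).le_opNorm (WithLp.toLp p v)

theorem exists_pnorm_equiv (p : ℝ≥0∞) [Fact (1 ≤ p)] (n m : ℕ) :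
    ∃ C : ℝ, 1 ≤ C ∧ ∀ x : State n m, pnorm p x ≤ C * ‖x‖ ∧ ‖x‖ ≤ C * pnorm p x := by
  obtain ⟨C, hC1, hC⟩ := exists_norm_toLp_equiv p (Fin n ⊕ Fin m)
  have h : ∀ x : State n m, ‖(Sum.elim x.1 x.2 : Fin n ⊕ Fin m → ℝ)‖ = ‖x‖ := by
    intro x
    apply le_antisymm
    · rw [pi_norm_le_iff_of_nonneg (norm_nonneg _)]
      rintro (i | i)
      · exact (norm_le_pi_norm x.1 i).trans (norm_fst_le x)
      · exact (norm_le_pi_norm x.2 i).trans (norm_snd_le x)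
    · rw [Prod.norm_def]
      refine max_le ?_ ?_
      · rw [pi_norm_le_iff_of_nonneg (norm_nonneg _)]
        exact fun i => norm_le_pi_norm (Sum.elim x.1 x.2 : Fin n ⊕ Fin m → ℝ) (Sum.inl i)
      · rw [pi_norm_le_iff_of_nonneg (norm_nonneg _)]
        exact fun i => norm_le_pi_norm (Sum.elim x.1 x.2 : Fin n ⊕ Fin m → ℝ) (Sum.inr i)
  refine ⟨C, hC1, fun x => ?_⟩
  rw [← h x]
  exact hC _

/-- A function on `[0, 1]` that is `c`-Lipschitz near every point, with the point itself as one of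
the two arguments, moves its endpoints apart by at most `c`. -/
theorem norm_sub_le_of_eventually_lipschitz {E : Type*} [NormedAddCommGroup E] {F : ℝ → E} {c : ℝ}
    (h : ∀ s ∈ Icc (0 : ℝ) 1, ∀ᶠ s' in 𝓝[Icc 0 1] s, ‖F s' - F s‖ ≤ c * |s' - s|) :
    ‖F 1 - F 0‖ ≤ c := by
  have hcont : ContinuousOn F (Icc 0 1) := by
    intro s hs
    rw [ContinuousWithinAt, tendsto_iff_norm_sub_tendsto_zero]
    refine squeeze_zero' (Eventually.of_forall fun _ => norm_nonneg _) (h s hs) ?_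
    have : Tendsto (fun s' : ℝ => c * |s' - s|) (𝓝 s) (𝓝 (c * |s - s|)) :=
      Continuous.tendsto (by fun_prop) s
    simp only [sub_self, abs_zero, mul_zero] at this
    exact this.mono_left nhdsWithin_le_nhds
  have := le_gronwallBound_of_liminf_deriv_right_le (f := fun s => ‖F s - F 0‖)
    (f' := fun _ => c) (δ := 0) (K := 0) (ε := c) (a := 0) (b := 1)
    (hcont.sub continuousOn_const).norm ?_ (by simp) (by simp) 1 (by simp)
  · simpa [gronwallBound_K0] using this
  · intro s hs r hr
    refine Eventually.frequently ?_
    have h1 := h s (Ico_subset_Icc_self hs)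
    have h2 : 𝓝[>] s ≤ 𝓝[Icc 0 1] s := by
      rw [← nhdsWithin_Ioc_eq_nhdsGT hs.2]
      exact nhdsWithin_mono _ fun z hz => ⟨hs.1.trans hz.1.le, hz.2⟩
    filter_upwards [h2 h1, self_mem_nhdsWithin] with z hz hzs
    have hpos : 0 < z - s := sub_pos.2 hzs
    rw [abs_of_pos hpos] at hz
    rw [inv_mul_lt_iff₀ hpos]
    have : ‖F z - F 0‖ ≤ ‖F z - F s‖ + ‖F s - F 0‖ := norm_sub_le_norm_sub_add_norm_sub _ _ _
    nlinarith

/-! ### The logarithmic norm -/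

/-- The logarithmic norm bounds the one-sided growth of `‖u‖` in the direction `J u`. -/
theorem eventually_norm_add_smul_mulVec_le (q : ℝ≥0∞) [Fact (1 ≤ q)]
    {J : Matrix (Fin n) (Fin n) ℝ} {b c : ℝ} (hJ : matrixMeasure q J ≤ b) (hbc : b < c)
    (u : Fin n → ℝ) :
    ∀ᶠ h in 𝓝[>] (0 : ℝ), ‖(WithLp.toLp q (u + h • (J *ᵥ u)) : PiLp q fun _ : Fin n => ℝ)‖ ≤
      (1 + h * c) * ‖(WithLp.toLp q u : PiLp q fun _ : Fin n => ℝ)‖ := by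
  rcases Nat.eq_zero_or_pos n with rfl | hn
  · -- in dimension `0` the logarithmic norm is a junk value, but all vectors vanish
    refine Eventually.of_forall fun h => ?_
    have h0 : ∀ v : Fin 0 → ℝ, (WithLp.toLp q v : PiLp q fun _ : Fin 0 => ℝ) = 0 :=
      fun v => Subsingleton.elim _ _
    rw [h0, h0, norm_zero, mul_zero]
  · filter_upwards [(tendsto_matrixMeasure q hn J).eventually (gt_mem_nhds (hJ.trans_lt hbc)),
      self_mem_nhdsWithin] with h hh hpos
    have hpos' : 0 < h := hpos
    rw [div_lt_iff₀ hpos'] at hh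
    have h1 := norm_toLp_mulVec_le q (1 + h • J) u
    rw [Matrix.add_mulVec, Matrix.one_mulVec, Matrix.smul_mulVec] at h1
    refine h1.trans (mul_le_mul_of_nonneg_right ?_ (norm_nonneg _))
    linarith

/-! ### Linearization along the constraint -/

theorem fderiv_apply_eq_partial {k : ℕ} {F : State n m → Fin k → ℝ} {x : State n m}
    (hF : DifferentiableAt ℝ F x) (d : State n m) :
    fderiv ℝ F x d = partialW F x *ᵥ d.1 + partialZ F x *ᵥ d.2 := by
  have hw : HasFDerivAt (fun w : Fin n → ℝ => F (w, x.2)) _ x.1 :=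
    HasFDerivAt.comp x.1 (g := F) (f := fun w => (w, x.2)) hF.hasFDerivAt
      (hasFDerivAt_prodMk_left x.1 x.2)
  have hz : HasFDerivAt (fun z : Fin m → ℝ => F (x.1, z)) _ x.2 :=
    HasFDerivAt.comp x.2 (g := F) (f := fun z => (x.1, z)) hF.hasFDerivAt
      (hasFDerivAt_prodMk_right x.1 x.2)
  rw [partialW, partialZ, LinearMap.toMatrix'_mulVec, LinearMap.toMatrix'_mulVec, hw.fderiv,
    hz.fderiv]
  change fderiv ℝ F x d = fderiv ℝ F x (d.1, 0) + fderiv ℝ F x (0, d.2)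
  rw [← map_add]
  simp

theorem continuous_partialW {k : ℕ} {F : State n m → Fin k → ℝ} (hF : ContDiff ℝ 1 F) :
    Continuous (partialW F) := by
  refine continuous_matrix fun i j => ?_
  have h : ∀ x, partialW F x i j = fderiv ℝ F x (Pi.single j 1, 0) i := by
    intro x
    rw [fderiv_apply_eq_partial (hF.differentiable one_ne_zero x)]
    simp
  simp only [h]
  exact (continuous_apply i).comp ((hF.continuous_fderiv one_ne_zero).clm_apply continuous_const)

theorem continuous_partialZ {k : ℕ} {F : State n m → Fin k → ℝ} (hF : ContDiff ℝ 1 F) :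
    Continuous (partialZ F) := by
  refine continuous_matrix fun i j => ?_
  have h : ∀ x, partialZ F x i j = fderiv ℝ F x (0, Pi.single j 1) i := by
    intro x
    rw [fderiv_apply_eq_partial (hF.differentiable one_ne_zero x)]
    simp
  simp only [h]
  exact (continuous_apply i).comp ((hF.continuous_fderiv one_ne_zero).clm_apply continuous_const)

theorem continuousAt_algSlope {g : State n m → Fin m → ℝ} (hg : ContDiff ℝ 1 g) {x : State n m}
    (hx : IsUnit (partialZ g x)) : ContinuousAt (algSlope g) x := by
  have hdet : IsUnit (partialZ g x).det := (Matrix.isUnit_iff_isUnit_det _).1 hx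
  have h1 : ContinuousAt (fun y => (partialZ g y)⁻¹) x := by
    refine ContinuousAt.comp (g := fun A : Matrix (Fin m) (Fin m) ℝ => A⁻¹)
      (continuousAt_matrix_inv _ ?_) (continuous_partialZ hg).continuousAt
    rw [Ring.inverse_eq_inv']
    exact continuousAt_inv₀ hdet.ne_zero
  exact ContinuousAt.comp
    (g := fun P : Matrix (Fin m) (Fin m) ℝ × Matrix (Fin m) (Fin n) ℝ => P.1 * P.2)
    (continuous_fst.matrix_mul continuous_snd).continuousAt
    (h1.prodMk (continuous_partialW hg).continuousAt)

theorem continuousAt_reducedMatrix {f : State n m → Fin n → ℝ} {g : State n m → Fin m → ℝ}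
    (hf : ContDiff ℝ 1 f) (hg : ContDiff ℝ 1 g) {x : State n m} (hx : IsUnit (partialZ g x)) :
    ContinuousAt (reducedMatrix f g) x :=
  (continuous_partialW hf).continuousAt.sub
    (ContinuousAt.comp
      (g := fun P : Matrix (Fin n) (Fin m) ℝ × Matrix (Fin m) (Fin n) ℝ => P.1 * P.2)
      (continuous_fst.matrix_mul continuous_snd).continuousAt
      ((continuous_partialZ hf).continuousAt.prodMk (continuousAt_algSlope hg hx)))

/-- Near a point where `∂g/∂z` is invertible, two points `x, y` of the constraint set satisfy
`Δz = -[∂g/∂z]⁻¹ ∂g/∂w Δw + o(Δw)`. This takes the place of the implicit function theorem. -/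
theorem eventually_norm_snd_add_le {g : State n m → Fin m → ℝ} (hg : ContDiff ℝ 1 g)
    {x₀ : State n m} (hx₀ : IsUnit (partialZ g x₀)) {η : ℝ} (hη : 0 < η) :
    ∀ᶠ p in 𝓝 (x₀, x₀), g p.1 = 0 → g p.2 = 0 →
      ‖(p.2 - p.1).2 + algSlope g x₀ *ᵥ (p.2 - p.1).1‖ ≤ η * ‖(p.2 - p.1).1‖ := by
  set S := algSlope g x₀ with hS
  set G := (partialZ g x₀)⁻¹ with hG
  have hdet : IsUnit (partialZ g x₀).det := (Matrix.isUnit_iff_isUnit_det _).1 hx₀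
  -- the first bound absorbs the error term in `Δz`, the second one yields the factor `η`
  obtain ⟨ε, hε, hε1, hε2⟩ : ∃ ε : ℝ, 0 < ε ∧ ‖G‖ * ε ≤ 1 / 2 ∧
      2 * (‖G‖ * ε) * (1 + ‖S‖) ≤ η := by
    refine ⟨min (1 / (2 * (1 + ‖G‖))) (η / (2 * (1 + ‖G‖) * (1 + ‖S‖))), by positivity, ?_, ?_⟩
    · calc _ ≤ (1 + ‖G‖) * (1 / (2 * (1 + ‖G‖))) := by
            gcongr
            · linarith
            · exact min_le_left _ _
        _ = 1 / 2 := by field_simp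
    · calc _ ≤ 2 * ((1 + ‖G‖) * (η / (2 * (1 + ‖G‖) * (1 + ‖S‖)))) * (1 + ‖S‖) := by
            gcongr
            · linarith
            · exact min_le_right _ _
        _ = η := by field_simp
  have hstrict := (hg.contDiffAt (x := x₀)).hasStrictFDerivAt one_ne_zero
  filter_upwards [(hasStrictFDerivAt_iff_isLittleO.1 hstrict).def hε] with p hp h1 h2
  -- `hp` bounds the linearization error of `g p.1 - g p.2`, so the increment is `p.1 - p.2`
  rw [h1, h2, sub_self, zero_sub, norm_neg,
    fderiv_apply_eq_partial (hg.differentiable one_ne_zero x₀)] at hp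
  set d := p.2 - p.1 with hd
  have hpd : p.1 - p.2 = -d := by rw [hd, neg_sub]
  rw [hpd, norm_neg] at hp
  have e1 : d.2 + S *ᵥ d.1 = -(G *ᵥ (partialW g x₀ *ᵥ (-d).1 + partialZ g x₀ *ᵥ (-d).2)) := by
    rw [Matrix.mulVec_add, Matrix.mulVec_mulVec, Matrix.mulVec_mulVec, hG,
      Matrix.nonsing_inv_mul _ hdet, hS, algSlope]
    simp only [Prod.fst_neg, Prod.snd_neg, Matrix.one_mulVec, Matrix.mulVec_neg]
    abel
  have e2 : ‖d.2 + S *ᵥ d.1‖ ≤ ‖G‖ * ε * ‖d‖ := by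
    rw [e1, norm_neg, mul_assoc]
    exact (Matrix.linfty_opNorm_mulVec _ _).trans (mul_le_mul_of_nonneg_left hp (norm_nonneg _))
  have e3 : ‖d.2‖ ≤ ‖d.2 + S *ᵥ d.1‖ + ‖S‖ * ‖d.1‖ := by
    have := norm_sub_le (d.2 + S *ᵥ d.1) (S *ᵥ d.1)
    rw [add_sub_cancel_right] at this
    exact this.trans (by gcongr; exact Matrix.linfty_opNorm_mulVec _ _)
  have e4 : ‖d‖ ≤ ‖d.1‖ + ‖d.2‖ := by
    rw [Prod.norm_def]
    exact max_le (by linarith [norm_nonneg d.2]) (by linarith [norm_nonneg d.1])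
  have hGε : 0 ≤ ‖G‖ * ε := by positivity
  have e5 : ‖d.2 + S *ᵥ d.1‖ ≤ ‖G‖ * ε * ((1 + ‖S‖) * ‖d.1‖ + ‖d.2 + S *ᵥ d.1‖) :=
    e2.trans (mul_le_mul_of_nonneg_left (by linarith) hGε)
  have e6 : ‖G‖ * ε * ‖d.2 + S *ᵥ d.1‖ ≤ 1 / 2 * ‖d.2 + S *ᵥ d.1‖ :=
    mul_le_mul_of_nonneg_right hε1 (norm_nonneg _)
  have e7 : 2 * (‖G‖ * ε) * (1 + ‖S‖) * ‖d.1‖ ≤ η * ‖d.1‖ :=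
    mul_le_mul_of_nonneg_right hε2 (norm_nonneg _)
  linarith

/-- On the constraint set, `∂f/∂w - ∂f/∂z [∂g/∂z]⁻¹ ∂g/∂w` is the derivative of `f` as a function
of `w`. -/
theorem eventually_norm_sub_reducedMatrix_le {f : State n m → Fin n → ℝ}
    {g : State n m → Fin m → ℝ} (hf : ContDiff ℝ 1 f) (hg : ContDiff ℝ 1 g)
    {x₀ : State n m} (hx₀ : IsUnit (partialZ g x₀)) {η : ℝ} (hη : 0 < η) :
    ∀ᶠ p in 𝓝 (x₀, x₀), g p.1 = 0 → g p.2 = 0 →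
      ‖f p.2 - f p.1 - reducedMatrix f g x₀ *ᵥ (p.2 - p.1).1‖ ≤ η * ‖(p.2 - p.1).1‖ := by
  set S := algSlope g x₀ with hS
  set B := partialZ f x₀ with hB
  obtain ⟨ε, hε, hε1⟩ : ∃ ε : ℝ, 0 < ε ∧ ε * (2 + ‖S‖) ≤ η / 2 :=
    ⟨η / 2 / (2 + ‖S‖), by positivity, by field_simp; rfl⟩
  obtain ⟨θ, hθ, hθ1, hθ2⟩ : ∃ θ : ℝ, 0 < θ ∧ θ ≤ 1 ∧ ‖B‖ * θ ≤ η / 2 := by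
    refine ⟨min 1 (η / 2 / (1 + ‖B‖)), by positivity, min_le_left _ _, ?_⟩
    calc _ ≤ (1 + ‖B‖) * (η / 2 / (1 + ‖B‖)) := by
          gcongr
          · linarith
          · exact min_le_right _ _
      _ = η / 2 := by field_simp
  have hstrict := (hf.contDiffAt (x := x₀)).hasStrictFDerivAt one_ne_zero
  filter_upwards [(hasStrictFDerivAt_iff_isLittleO.1 hstrict).def hε,
    eventually_norm_snd_add_le hg hx₀ hθ] with p hp hz h1 h2
  specialize hz h1 h2
  rw [fderiv_apply_eq_partial (hf.differentiable one_ne_zero x₀)] at hp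
  set d := p.2 - p.1 with hd
  have hpd : p.1 - p.2 = -d := by rw [hd, neg_sub]
  rw [hpd, norm_neg] at hp
  have e1 : f p.2 - f p.1 - reducedMatrix f g x₀ *ᵥ d.1 =
      -(f p.1 - f p.2 - (partialW f x₀ *ᵥ (-d).1 + B *ᵥ (-d).2)) + B *ᵥ (d.2 + S *ᵥ d.1) := by
    rw [reducedMatrix, ← hS, ← hB, Matrix.sub_mulVec, ← Matrix.mulVec_mulVec, Matrix.mulVec_add]
    simp only [Prod.fst_neg, Prod.snd_neg, Matrix.mulVec_neg]
    abel
  have e3 : ‖d.2‖ ≤ ‖d.2 + S *ᵥ d.1‖ + ‖S‖ * ‖d.1‖ := by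
    have := norm_sub_le (d.2 + S *ᵥ d.1) (S *ᵥ d.1)
    rw [add_sub_cancel_right] at this
    exact this.trans (by gcongr; exact Matrix.linfty_opNorm_mulVec _ _)
  have e4 : ‖d‖ ≤ ‖d.1‖ + ‖d.2‖ := by
    rw [Prod.norm_def]
    exact max_le (by linarith [norm_nonneg d.2]) (by linarith [norm_nonneg d.1])
  have e5 : ‖d‖ ≤ (2 + ‖S‖) * ‖d.1‖ := by nlinarith [norm_nonneg d.1]
  calc _ ≤ ε * ‖d‖ + ‖B‖ * (θ * ‖d.1‖) := by
        rw [e1]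
        refine (norm_add_le _ _).trans (add_le_add ?_ ?_)
        · rwa [norm_neg]
        · exact (Matrix.linfty_opNorm_mulVec _ _).trans
            (mul_le_mul_of_nonneg_left hz (norm_nonneg _))
    _ ≤ ε * ((2 + ‖S‖) * ‖d.1‖) + ‖B‖ * (θ * ‖d.1‖) := by gcongr
    _ = (ε * (2 + ‖S‖) + ‖B‖ * θ) * ‖d.1‖ := by ring
    _ ≤ η * ‖d.1‖ := mul_le_mul_of_nonneg_right (by linarith) (norm_nonneg _)

/-- Within distance `r` of the reference point `x`, the increments from `x` to points `y` of the
constraint set are controlled by the increment of `w`: that of `f` is given by the matrix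
`reducedMatrix f g x` up to the relative error `η`, and that of `z` is at most `L` times as large.
The reference point is fixed, so that nothing is said about two arbitrary points of the tube. -/
def HasTube (f : State n m → Fin n → ℝ) (g : State n m → Fin m → ℝ) (η r L : ℝ)
    (x : State n m) : Prop :=
  ∀ y, g y = 0 → ‖y - x‖ ≤ r →
    ‖f y - f x - reducedMatrix f g x *ᵥ (y - x).1‖ ≤ η * ‖(y - x).1‖ ∧
      ‖(y - x).2‖ ≤ L * ‖(y - x).1‖

theorem HasTube.mono {f : State n m → Fin n → ℝ} {g : State n m → Fin m → ℝ} {η r r' L L' : ℝ}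
    {x : State n m} (h : HasTube f g η r L x) (hr : r' ≤ r) (hL : L ≤ L') :
    HasTube f g η r' L' x := fun y hy hyx =>
  ⟨(h y hy (hyx.trans hr)).1,
    (h y hy (hyx.trans hr)).2.trans (mul_le_mul_of_nonneg_right hL (norm_nonneg _))⟩

theorem exists_hasTube_near {f : State n m → Fin n → ℝ} {g : State n m → Fin m → ℝ}
    (hf : ContDiff ℝ 1 f) (hg : ContDiff ℝ 1 g) {x₀ : State n m}
    (hx₀ : IsUnit (partialZ g x₀)) {η : ℝ} (hη : 0 < η) :
    ∃ r L : ℝ, 0 < r ∧ ∀ᶠ x in 𝓝 x₀, g x = 0 → HasTube f g η r L x := by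
  have hA : ∀ᶠ x in 𝓝 x₀, ‖reducedMatrix f g x - reducedMatrix f g x₀‖ < η / 2 := by
    have := Metric.tendsto_nhds.1 (continuousAt_reducedMatrix hf hg hx₀) (η / 2) (half_pos hη)
    simpa only [dist_eq_norm] using this
  have h2 := eventually_norm_sub_reducedMatrix_le hf hg hx₀ (half_pos hη)
  have h3 := eventually_norm_snd_add_le hg hx₀ one_pos
  obtain ⟨r, hr, hball⟩ := Metric.eventually_nhds_iff_ball.1 (h2.and h3)
  refine ⟨r / 2, 1 + ‖algSlope g x₀‖, half_pos hr, ?_⟩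
  filter_upwards [hA, Metric.ball_mem_nhds x₀ (half_pos hr)] with x hxA hxr hgx y hgy hyx
  have hx' : dist x x₀ < r / 2 := hxr
  have hy' : dist y x₀ < r := by
    have := dist_triangle y x x₀
    rw [dist_eq_norm y x] at this
    linarith
  obtain ⟨k2, k3⟩ := hball (x, y) (by
    rw [Metric.mem_ball, Prod.dist_eq]
    exact max_lt (by linarith) hy')
  specialize k2 hgx hgy
  specialize k3 hgx hgy
  simp only at k2 k3
  constructor
  · have e : f y - f x - reducedMatrix f g x *ᵥ (y - x).1 =
        (f y - f x - reducedMatrix f g x₀ *ᵥ (y - x).1) -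
          (reducedMatrix f g x - reducedMatrix f g x₀) *ᵥ (y - x).1 := by
      rw [Matrix.sub_mulVec]
      abel
    have h4 := Matrix.linfty_opNorm_mulVec (reducedMatrix f g x - reducedMatrix f g x₀) (y - x).1
    have h5 := mul_le_mul_of_nonneg_right hxA.le (norm_nonneg (y - x).1)
    rw [e]
    refine (norm_sub_le _ _).trans ?_
    linarith
  · have := norm_sub_le ((y - x).2 + algSlope g x₀ *ᵥ (y - x).1) (algSlope g x₀ *ᵥ (y - x).1)
    rw [add_sub_cancel_right] at this
    have h4 := Matrix.linfty_opNorm_mulVec (algSlope g x₀) (y - x).1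
    linarith

/-- The radius and the Lipschitz constant of the tube can be chosen uniformly over a compact set of
reference points. -/
theorem exists_hasTube_of_isCompact {f : State n m → Fin n → ℝ} {g : State n m → Fin m → ℝ}
    (hf : ContDiff ℝ 1 f) (hg : ContDiff ℝ 1 g) {K : Set (State n m)} (hK : IsCompact K)
    (hunit : ∀ x ∈ K, IsUnit (partialZ g x)) (hgK : ∀ x ∈ K, g x = 0) {η : ℝ} (hη : 0 < η) :
    ∃ r L : ℝ, 0 < r ∧ 0 ≤ L ∧ ∀ x ∈ K, HasTube f g η r L x := by
  suffices h : ∃ r L : ℝ, 0 < r ∧ 0 ≤ L ∧ ∀ x ∈ K, g x = 0 → HasTube f g η r L x by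
    obtain ⟨r, L, hr, hL, h⟩ := h
    exact ⟨r, L, hr, hL, fun x hx => h x hx (hgK x hx)⟩
  refine hK.induction_on (p := fun s => ∃ r L : ℝ, 0 < r ∧ 0 ≤ L ∧
    ∀ x ∈ s, g x = 0 → HasTube f g η r L x) ⟨1, 0, one_pos, le_rfl, by simp⟩ ?_ ?_ ?_
  · rintro s t hst ⟨r, L, hr, hL, h⟩
    exact ⟨r, L, hr, hL, fun x hx => h x (hst hx)⟩
  · rintro s t ⟨r, L, hr, hL, h⟩ ⟨r', L', hr', hL', h'⟩
    refine ⟨min r r', max L L', lt_min hr hr', le_max_of_le_left hL, ?_⟩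
    rintro x (hx | hx) hgx
    · exact (h x hx hgx).mono (min_le_left _ _) (le_max_left _ _)
    · exact (h' x hx hgx).mono (min_le_right _ _) (le_max_right _ _)
  · intro x hx
    obtain ⟨r, L, hr, h⟩ := exists_hasTube_near hf hg (hunit x hx) hη
    exact ⟨_, mem_nhdsWithin_of_mem_nhds h, r, max L 0, hr, le_max_right _ _,
      fun y hy hgy => (hy hgy).mono le_rfl (le_max_left _ _)⟩

/-! ### Solutions -/

theorem IsSolution.comp_add {f : State n m → Fin n → ℝ} {g : State n m → Fin m → ℝ}
    {x : ℝ → State n m} (hx : IsSolution f g 0 x) (t₀ : ℝ) :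
    IsSolution f g t₀ (fun t => x (t - t₀)) := by
  have hmaps : MapsTo (fun t : ℝ => t - t₀) (Ici t₀) (Ici 0) := fun t ht => sub_nonneg.2 (mem_Ici.1 ht)
  refine ⟨hx.contDiffOn.comp (by fun_prop) hmaps, fun t ht => ?_,
    fun t ht => hx.constraint _ (hmaps ht)⟩
  have h := (hx.hasDerivWithinAt (t - t₀) (hmaps ht)).scomp t
    ((hasDerivWithinAt_id t (Ici t₀)).sub_const t₀) hmaps
  rw [one_smul] at h
  exact h

theorem isSolution_zero {f : State n m → Fin n → ℝ} {g : State n m → Fin m → ℝ}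
    (hf0 : f 0 = 0) (hg0 : g 0 = 0) (t₀ : ℝ) : IsSolution f g t₀ (fun _ => 0) := by
  refine ⟨contDiffOn_const, fun t _ => ?_, fun t _ => hg0⟩
  rw [hf0]
  exact hasDerivWithinAt_const _ _ _

theorem IsSolution.continuousOn {f : State n m → Fin n → ℝ} {g : State n m → Fin m → ℝ} {t₀ : ℝ}
    {x : ℝ → State n m} (hx : IsSolution f g t₀ x) : ContinuousOn x (Ici t₀) :=
  hx.contDiffOn.continuousOn

/-- Differentiating the constraint in time gives the full velocity of a solution. -/
theorem IsSolution.hasDerivWithinAt_velocity {f : State n m → Fin n → ℝ}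
    {g : State n m → Fin m → ℝ} (hg : ContDiff ℝ 1 g) {t₀ : ℝ} {x : ℝ → State n m}
    (hx : IsSolution f g t₀ x) {t : ℝ} (ht : t ∈ Ici t₀) (hu : IsUnit (partialZ g (x t))) :
    HasDerivWithinAt x (velocity f g (x t)) (Ici t₀) t := by
  have hud : UniqueDiffWithinAt ℝ (Ici t₀) t := uniqueDiffOn_Ici t₀ t ht
  have hd : HasDerivWithinAt x (derivWithin x (Ici t₀) t) (Ici t₀) t :=
    (hx.contDiffOn.differentiableOn one_ne_zero t ht).hasDerivWithinAt
  set d := derivWithin x (Ici t₀) t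
  have h1 : d.1 = f (x t) :=
    hud.eq_deriv _ hd.fst (hx.hasDerivWithinAt t ht)
  have hgd : HasDerivWithinAt (g ∘ x) (fderiv ℝ g (x t) d) (Ici t₀) t :=
    (hg.differentiable one_ne_zero (x t)).hasFDerivAt.comp_hasDerivWithinAt t hd
  have hg0 : HasDerivWithinAt (g ∘ x) 0 (Ici t₀) t :=
    (hasDerivWithinAt_const t (Ici t₀) (0 : Fin m → ℝ)).congr (fun s hs => hx.constraint s hs)
      (hx.constraint t ht)
  have h2 := hud.eq_deriv _ hgd hg0
  rw [fderiv_apply_eq_partial (hg.differentiable one_ne_zero (x t)), h1] at h2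
  have h3 : d.2 = -(algSlope g (x t) *ᵥ f (x t)) := by
    have hdet : IsUnit (partialZ g (x t)).det := (Matrix.isUnit_iff_isUnit_det _).1 hu
    have h4 := congrArg (fun v => (partialZ g (x t))⁻¹ *ᵥ v) h2
    simp only [Matrix.mulVec_add, Matrix.mulVec_mulVec, Matrix.nonsing_inv_mul _ hdet,
      Matrix.one_mulVec, Matrix.mulVec_zero] at h4
    rw [algSlope]
    exact eq_neg_of_add_eq_zero_right h4
  have h5 : d = velocity f g (x t) := Prod.ext h1 h3
  rwa [h5] at hd

/-! ### Contraction towards a reference solution -/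

/-- The hypotheses of the contraction estimate at one point `x` of the constraint set, with
explicit bounds `κ` for the metric `M` and its inverse. -/
structure IsContractionPoint (q : ℝ≥0∞) [Fact (1 ≤ q)] (f : State n m → Fin n → ℝ)
    (g : State n m → Fin m → ℝ) (M : State n m → Matrix (Fin n) (Fin n) ℝ) (β κ : ℝ)
    (x : State n m) : Prop where
  isUnit_partialZ : IsUnit (partialZ g x)
  differentiableAt : ∀ i j, DifferentiableAt ℝ (fun y => M y i j) x
  isUnit : IsUnit (M x)
  matrixMeasure_le : matrixMeasure q (JM f g M x) ≤ -β
  inducedNorm_le : inducedNorm q (M x) ≤ κ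
  inducedNorm_inv_le : inducedNorm q (M x)⁻¹ ≤ κ

theorem IsContractionPoint.norm_mulVec_le {q : ℝ≥0∞} [Fact (1 ≤ q)] {f : State n m → Fin n → ℝ}
    {g : State n m → Fin m → ℝ} {M : State n m → Matrix (Fin n) (Fin n) ℝ} {β κ : ℝ}
    {x : State n m} (h : IsContractionPoint q f g M β κ x) (v : Fin n → ℝ) :
    ‖(WithLp.toLp q (M x *ᵥ v) : PiLp q fun _ : Fin n => ℝ)‖ ≤
      κ * ‖(WithLp.toLp q v : PiLp q fun _ : Fin n => ℝ)‖ :=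
  (norm_toLp_mulVec_le q (M x) v).trans
    (mul_le_mul_of_nonneg_right h.inducedNorm_le (norm_nonneg _))

theorem IsContractionPoint.norm_le_mulVec {q : ℝ≥0∞} [Fact (1 ≤ q)] {f : State n m → Fin n → ℝ}
    {g : State n m → Fin m → ℝ} {M : State n m → Matrix (Fin n) (Fin n) ℝ} {β κ : ℝ}
    {x : State n m} (h : IsContractionPoint q f g M β κ x) (v : Fin n → ℝ) :
    ‖(WithLp.toLp q v : PiLp q fun _ : Fin n => ℝ)‖ ≤
      κ * ‖(WithLp.toLp q (M x *ᵥ v) : PiLp q fun _ : Fin n => ℝ)‖ := by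
  have hdet : IsUnit (M x).det := (Matrix.isUnit_iff_isUnit_det _).1 h.isUnit
  have h1 := norm_toLp_mulVec_le q (M x)⁻¹ (M x *ᵥ v)
  rw [Matrix.mulVec_mulVec, Matrix.nonsing_inv_mul _ hdet, Matrix.one_mulVec] at h1
  exact h1.trans (mul_le_mul_of_nonneg_right h.inducedNorm_inv_le (norm_nonneg _))

/-- The upper right Dini derivative of `‖v‖` is at most `μ(J) ‖v‖ + ‖ρ‖` when `v' = J v + ρ`. -/
theorem eventually_slope_norm_lt (q : ℝ≥0∞) [Fact (1 ≤ q)] {J : Matrix (Fin n) (Fin n) ℝ}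
    {b t r : ℝ} (hJ : matrixMeasure q J ≤ b) {v : ℝ → Fin n → ℝ} {ρ : Fin n → ℝ}
    (hv : HasDerivWithinAt v (J *ᵥ v t + ρ) (Ici t) t)
    (hr : b * ‖(WithLp.toLp q (v t) : PiLp q fun _ : Fin n => ℝ)‖ +
      ‖(WithLp.toLp q ρ : PiLp q fun _ : Fin n => ℝ)‖ < r) :
    ∀ᶠ z in 𝓝[>] t, (z - t)⁻¹ * (‖(WithLp.toLp q (v z) : PiLp q fun _ : Fin n => ℝ)‖ -
      ‖(WithLp.toLp q (v t) : PiLp q fun _ : Fin n => ℝ)‖) < r := by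
  set a := ‖(WithLp.toLp q (v t) : PiLp q fun _ : Fin n => ℝ)‖ with ha
  set d := ‖(WithLp.toLp q ρ : PiLp q fun _ : Fin n => ℝ)‖ with hd
  have ha0 : 0 ≤ a := norm_nonneg _
  obtain ⟨ε, hε, hεr⟩ : ∃ ε : ℝ, 0 < ε ∧ (b + ε) * a + d + ε < r := by
    refine ⟨(r - (b * a + d)) / (2 * (1 + a)), div_pos (sub_pos.2 hr) (by positivity), ?_⟩
    have : (r - (b * a + d)) / (2 * (1 + a)) * (1 + a) = (r - (b * a + d)) / 2 := by field_simp
    linarith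
  have hV : HasDerivWithinAt (fun s => (WithLp.toLp q (v s) : PiLp q fun _ : Fin n => ℝ))
      (WithLp.toLp q (J *ᵥ v t + ρ)) (Ici t) t :=
    (PiLp.continuousLinearEquiv q ℝ
      (fun _ : Fin n => ℝ)).symm.toContinuousLinearMap.hasFDerivAt.comp_hasDerivWithinAt t hv
  have hlit := (hasDerivWithinAt_iff_isLittleO.1 hV).def hε
  have hlit' : ∀ᶠ z in 𝓝[>] t, _ := hlit.filter_mono (nhdsWithin_mono _ Ioi_subset_Ici_self)
  have hshift : Tendsto (fun z => z - t) (𝓝[>] t) (𝓝[>] 0) := by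
    refine tendsto_nhdsWithin_iff.2 ⟨?_, ?_⟩
    · have : Tendsto (fun z => z - t) (𝓝 t) (𝓝 (t - t)) := Continuous.tendsto (by fun_prop) t
      rw [sub_self] at this
      exact this.mono_left nhdsWithin_le_nhds
    · filter_upwards [self_mem_nhdsWithin] with z hz
      exact sub_pos.2 (mem_Ioi.1 hz)
  have hlog := hshift.eventually
    (eventually_norm_add_smul_mulVec_le q hJ (lt_add_of_pos_right b hε) (v t))
  filter_upwards [hlit', hlog, self_mem_nhdsWithin] with z h1 h2 hz
  have hpos : 0 < z - t := sub_pos.2 hz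
  rw [Real.norm_of_nonneg hpos.le] at h1
  have e : (WithLp.toLp q (v z) : PiLp q fun _ : Fin n => ℝ) =
      (WithLp.toLp q (v z) - WithLp.toLp q (v t) - (z - t) • WithLp.toLp q (J *ᵥ v t + ρ)) +
        (WithLp.toLp q (v t + (z - t) • (J *ᵥ v t)) + (z - t) • WithLp.toLp q ρ) := by
    simp only [WithLp.toLp_add, WithLp.toLp_smul, smul_add]
    abel
  have h3 : ‖(WithLp.toLp q (v z) : PiLp q fun _ : Fin n => ℝ)‖ ≤
      ε * (z - t) + ((1 + (z - t) * (b + ε)) * a + (z - t) * d) := by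
    rw [e]
    refine (norm_add_le _ _).trans (add_le_add h1 ((norm_add_le _ _).trans (add_le_add h2 ?_)))
    rw [norm_smul, Real.norm_of_nonneg hpos.le]
  rw [inv_mul_lt_iff₀ hpos]
  nlinarith

theorem hasDerivWithinAt_mulVec {A : ℝ → Matrix (Fin n) (Fin n) ℝ} {A' : Matrix (Fin n) (Fin n) ℝ}
    {e : ℝ → Fin n → ℝ} {e' : Fin n → ℝ} {s : Set ℝ} {t : ℝ}
    (hA : ∀ i j, HasDerivWithinAt (fun τ => A τ i j) (A' i j) s t)
    (he : HasDerivWithinAt e e' s t) :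
    HasDerivWithinAt (fun τ => A τ *ᵥ e τ) (A' *ᵥ e t + A t *ᵥ e') s t := by
  rw [hasDerivWithinAt_pi] at he ⊢
  intro i
  have h := HasDerivWithinAt.fun_sum (u := Finset.univ) fun j _ => (hA i j).fun_mul (he j)
  simpa only [Matrix.mulVec, dotProduct, Pi.add_apply, Finset.sum_add_distrib] using h

/-- The time derivative of `M e` along a solution, for `e' = A e`, is `J_M` applied to `M e`. -/
theorem JM_mulVec {f : State n m → Fin n → ℝ} {g : State n m → Fin m → ℝ}
    {M : State n m → Matrix (Fin n) (Fin n) ℝ} {x : State n m} (hM : IsUnit (M x))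
    (e : Fin n → ℝ) :
    JM f g M x *ᵥ (M x *ᵥ e) =
      matrixDot f g M x *ᵥ e + M x *ᵥ (reducedMatrix f g x *ᵥ e) := by
  have hdet : IsUnit (M x).det := (Matrix.isUnit_iff_isUnit_det _).1 hM
  rw [JM, Matrix.mulVec_mulVec, Matrix.add_mul, Matrix.mul_assoc, Matrix.nonsing_inv_mul _ hdet,
    Matrix.mul_one, Matrix.mul_assoc (M x * reducedMatrix f g x), Matrix.nonsing_inv_mul _ hdet,
    Matrix.mul_one, Matrix.add_mulVec, Matrix.mulVec_mulVec]

/-- As long as a solution `y` stays in the tube around the reference solution `x`, the weighted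
difference `M(x) (w_y - w_x)` decays exponentially. Only the values of `M` along `x` enter. -/
theorem norm_mulVec_sub_le_exp {q : ℝ≥0∞} [Fact (1 ≤ q)] {f : State n m → Fin n → ℝ}
    {g : State n m → Fin m → ℝ} {M : State n m → Matrix (Fin n) (Fin n) ℝ} {β κ C η r L : ℝ}
    (hg : ContDiff ℝ 1 g)
    (hC : ∀ v : Fin n → ℝ, ‖(WithLp.toLp q v : PiLp q fun _ : Fin n => ℝ)‖ ≤ C * ‖v‖ ∧
        ‖v‖ ≤ C * ‖(WithLp.toLp q v : PiLp q fun _ : Fin n => ℝ)‖)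
    (hC1 : 1 ≤ C) (hκ : 1 ≤ κ) (hη : 0 ≤ η) (hηβ : κ ^ 2 * C ^ 2 * η ≤ β / 2)
    {t₀ T : ℝ} {x y : ℝ → State n m} (hx : IsSolution f g t₀ x) (hy : IsSolution f g t₀ y)
    (hpt : ∀ t ∈ Icc t₀ T, IsContractionPoint q f g M β κ (x t))
    (htube : ∀ t ∈ Icc t₀ T, HasTube f g η r L (x t))
    (hyx : ∀ t ∈ Icc t₀ T, ‖y t - x t‖ ≤ r) :
    ∀ t ∈ Icc t₀ T, ‖(WithLp.toLp q (M (x t) *ᵥ (y t - x t).1) : PiLp q fun _ : Fin n => ℝ)‖ ≤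
      ‖(WithLp.toLp q (M (x t₀) *ᵥ (y t₀ - x t₀).1) : PiLp q fun _ : Fin n => ℝ)‖ *
        Real.exp (-(β / 2) * (t - t₀)) := by
  have hderiv : ∀ t ∈ Icc t₀ T, HasDerivWithinAt (fun s => M (x s) *ᵥ (y s - x s).1)
      (matrixDot f g M (x t) *ᵥ (y t - x t).1 + M (x t) *ᵥ (f (y t) - f (x t))) (Ici t₀) t := by
    intro t ht
    refine hasDerivWithinAt_mulVec (fun i j => ?_)
      ((hy.hasDerivWithinAt t ht.1).sub (hx.hasDerivWithinAt t ht.1))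
    exact ((hpt t ht).differentiableAt i j).hasFDerivAt.comp_hasDerivWithinAt t
      (hx.hasDerivWithinAt_velocity hg ht.1 (hpt t ht).isUnit_partialZ)
  have hcont : ContinuousOn (fun t =>
      ‖(WithLp.toLp q (M (x t) *ᵥ (y t - x t).1) : PiLp q fun _ : Fin n => ℝ)‖) (Icc t₀ T) := by
    intro t ht
    have h1 := ((hderiv t ht).continuousWithinAt).mono (Icc_subset_Ici_self : Icc t₀ T ⊆ Ici t₀)
    exact ((PiLp.continuousLinearEquiv q ℝ
      (fun _ : Fin n => ℝ)).symm.continuous.continuousAt.comp_continuousWithinAt h1).norm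
  intro t ht
  have key := le_gronwallBound_of_liminf_deriv_right_le hcont
    (f' := fun t => -(β / 2) *
      ‖(WithLp.toLp q (M (x t) *ᵥ (y t - x t).1) : PiLp q fun _ : Fin n => ℝ)‖)
    (K := -(β / 2)) (ε := 0) (hf' := ?_) le_rfl (fun t _ => by simp) t ht
  · rwa [gronwallBound_ε0] at key
  intro s hs r' hr'
  have hs' : s ∈ Icc t₀ T := Ico_subset_Icc_self hs
  set e := (y s - x s).1 with he
  set ρ := M (x s) *ᵥ (f (y s) - f (x s) - reducedMatrix f g (x s) *ᵥ e) with hρ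
  have hd : HasDerivWithinAt (fun s => M (x s) *ᵥ (y s - x s).1)
      (JM f g M (x s) *ᵥ (M (x s) *ᵥ e) + ρ) (Ici s) s := by
    have h1 := (hderiv s hs').mono (Ici_subset_Ici.2 hs.1)
    rw [JM_mulVec (hpt s hs').isUnit, hρ, Matrix.mulVec_sub]
    convert! h1 using 1
    abel
  have hρ' : ‖(WithLp.toLp q ρ : PiLp q fun _ : Fin n => ℝ)‖ ≤
      β / 2 * ‖(WithLp.toLp q (M (x s) *ᵥ e) : PiLp q fun _ : Fin n => ℝ)‖ := by
    have hκ0 : 0 ≤ κ := zero_le_one.trans hκ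
    have hC0 : 0 ≤ C := zero_le_one.trans hC1
    calc _ ≤ κ * (C * (η * (C * (κ *
            ‖(WithLp.toLp q (M (x s) *ᵥ e) : PiLp q fun _ : Fin n => ℝ)‖)))) := by
          refine ((hpt s hs').norm_mulVec_le _).trans (mul_le_mul_of_nonneg_left ?_ hκ0)
          refine (hC _).1.trans (mul_le_mul_of_nonneg_left ?_ hC0)
          refine (htube s hs' (y s) (hy.constraint s hs.1) (hyx s hs')).1.trans
            (mul_le_mul_of_nonneg_left ?_ hη)
          exact (hC _).2.trans (mul_le_mul_of_nonneg_left ((hpt s hs').norm_le_mulVec e) hC0)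
      _ = κ ^ 2 * C ^ 2 * η *
            ‖(WithLp.toLp q (M (x s) *ᵥ e) : PiLp q fun _ : Fin n => ℝ)‖ := by ring
      _ ≤ _ := mul_le_mul_of_nonneg_right hηβ (norm_nonneg _)
  exact (eventually_slope_norm_lt q (hpt s hs').matrixMeasure_le hd
    (lt_of_le_of_lt (by linarith) hr')).frequently

/-- The decay estimate for the unweighted difference; passing to `M(x) (w_y - w_x)` and back costs
the factor `κ ^ 2`. -/
theorem norm_sub_le_exp_of_mem_tube {q : ℝ≥0∞} [Fact (1 ≤ q)] {f : State n m → Fin n → ℝ}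
    {g : State n m → Fin m → ℝ} {M : State n m → Matrix (Fin n) (Fin n) ℝ} {β κ C η r L : ℝ}
    (hg : ContDiff ℝ 1 g)
    (hC : ∀ v : Fin n → ℝ, ‖(WithLp.toLp q v : PiLp q fun _ : Fin n => ℝ)‖ ≤ C * ‖v‖ ∧
        ‖v‖ ≤ C * ‖(WithLp.toLp q v : PiLp q fun _ : Fin n => ℝ)‖)
    (hC1 : 1 ≤ C) (hκ : 1 ≤ κ) (hη : 0 ≤ η) (hηβ : κ ^ 2 * C ^ 2 * η ≤ β / 2)
    {t₀ T : ℝ} {x y : ℝ → State n m} (hx : IsSolution f g t₀ x) (hy : IsSolution f g t₀ y)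
    (hpt : ∀ t ∈ Icc t₀ T, IsContractionPoint q f g M β κ (x t))
    (htube : ∀ t ∈ Icc t₀ T, HasTube f g η r L (x t))
    (hyx : ∀ t ∈ Icc t₀ T, ‖y t - x t‖ ≤ r) :
    ∀ t ∈ Icc t₀ T, ‖(WithLp.toLp q (y t - x t).1 : PiLp q fun _ : Fin n => ℝ)‖ ≤
      κ ^ 2 * Real.exp (-(β / 2) * (t - t₀)) *
        ‖(WithLp.toLp q (y t₀ - x t₀).1 : PiLp q fun _ : Fin n => ℝ)‖ := by
  intro t ht
  have h0 : t₀ ∈ Icc t₀ T := left_mem_Icc.2 (ht.1.trans ht.2)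
  have hκ0 : 0 ≤ κ := zero_le_one.trans hκ
  calc _ ≤ κ * (κ * ‖(WithLp.toLp q (y t₀ - x t₀).1 : PiLp q fun _ : Fin n => ℝ)‖ *
          Real.exp (-(β / 2) * (t - t₀))) := by
        refine ((hpt t ht).norm_le_mulVec _).trans (mul_le_mul_of_nonneg_left ?_ hκ0)
        refine (norm_mulVec_sub_le_exp hg hC hC1 hκ hη hηβ hx hy hpt htube hyx t ht).trans ?_
        exact mul_le_mul_of_nonneg_right ((hpt t₀ h0).norm_mulVec_le _) (Real.exp_nonneg _)
    _ = _ := by ring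

/-- A solution that starts close enough to the reference solution never leaves the tube: at a first
exit time the decay estimate would put it strictly inside. -/
theorem mem_tube_and_norm_sub_le_exp {q : ℝ≥0∞} [Fact (1 ≤ q)] {f : State n m → Fin n → ℝ}
    {g : State n m → Fin m → ℝ} {M : State n m → Matrix (Fin n) (Fin n) ℝ} {β κ C η r L : ℝ}
    (hg : ContDiff ℝ 1 g)
    (hC : ∀ v : Fin n → ℝ, ‖(WithLp.toLp q v : PiLp q fun _ : Fin n => ℝ)‖ ≤ C * ‖v‖ ∧
        ‖v‖ ≤ C * ‖(WithLp.toLp q v : PiLp q fun _ : Fin n => ℝ)‖)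
    (hC1 : 1 ≤ C) (hκ : 1 ≤ κ) (hη : 0 ≤ η) (hηβ : κ ^ 2 * C ^ 2 * η ≤ β / 2) (hβ : 0 ≤ β)
    (hL : 0 ≤ L) {t₀ T : ℝ} {x y : ℝ → State n m} (hx : IsSolution f g t₀ x)
    (hy : IsSolution f g t₀ y)
    (hpt : ∀ t ∈ Icc t₀ T, IsContractionPoint q f g M β κ (x t))
    (htube : ∀ t ∈ Icc t₀ T, HasTube f g η r L (x t))
    (hstart : (1 + L) * C ^ 2 * κ ^ 2 * ‖y t₀ - x t₀‖ < r) :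
    ∀ t ∈ Icc t₀ T, ‖y t - x t‖ ≤ r ∧
      ‖(WithLp.toLp q (y t - x t).1 : PiLp q fun _ : Fin n => ℝ)‖ ≤
        κ ^ 2 * Real.exp (-(β / 2) * (t - t₀)) *
          ‖(WithLp.toLp q (y t₀ - x t₀).1 : PiLp q fun _ : Fin n => ℝ)‖ := by
  have hC0 : 0 ≤ C := zero_le_one.trans hC1
  have hcont : ContinuousOn (fun t => ‖y t - x t‖) (Ici t₀) :=
    (hy.continuousOn.sub hx.continuousOn).norm
  have hstay : ∀ t ∈ Icc t₀ T, ‖y t - x t‖ < r := by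
    by_contra! hex
    have hclosed : IsClosed (Icc t₀ T ∩ (fun t => ‖y t - x t‖) ⁻¹' Ici r) :=
      (hcont.mono (Icc_subset_Ici_self : Icc t₀ T ⊆ Ici t₀)).preimage_isClosed_of_isClosed
        isClosed_Icc isClosed_Ici
    obtain ⟨t₁, ⟨ht₁, hr₁⟩, hmin⟩ :=
      (isCompact_Icc.of_isClosed_subset hclosed inter_subset_left).exists_isLeast hex
    have hr₁' : r ≤ ‖y t₁ - x t₁‖ := hr₁
    have hbefore : ∀ s ∈ Ico t₀ t₁, ‖y s - x s‖ ≤ r := by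
      intro s hs
      by_contra! hlt
      exact hs.2.not_ge (hmin ⟨⟨hs.1, hs.2.le.trans ht₁.2⟩, hlt.le⟩)
    have hfac : 1 ≤ (1 + L) * C ^ 2 * κ ^ 2 :=
      one_le_mul_of_one_le_of_one_le (one_le_mul_of_one_le_of_one_le (by linarith)
        (one_le_pow₀ hC1)) (one_le_pow₀ hκ)
    have hne : t₀ ≠ t₁ := by
      rintro rfl
      have := le_mul_of_one_le_left (norm_nonneg (y t₀ - x t₀)) hfac
      linarith
    have hclos : t₁ ∈ closure (Ico t₀ t₁) := by
      rw [closure_Ico hne]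
      exact right_mem_Icc.2 ht₁.1
    have hat : ‖y t₁ - x t₁‖ ≤ r :=
      ContinuousWithinAt.closure_le hclos
        ((hcont t₁ ht₁.1).mono (Ico_subset_Icc_self.trans Icc_subset_Ici_self))
        continuousWithinAt_const hbefore
    have hupto : ∀ s ∈ Icc t₀ t₁, ‖y s - x s‖ ≤ r := by
      intro s hs
      rcases hs.2.eq_or_lt with rfl | hlt
      · exact hat
      · exact hbefore s ⟨hs.1, hlt⟩
    have hsub : Icc t₀ t₁ ⊆ Icc t₀ T := Icc_subset_Icc_right ht₁.2
    have hdec := norm_sub_le_exp_of_mem_tube hg hC hC1 hκ hη hηβ hx hy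
      (fun s hs => hpt s (hsub hs)) (fun s hs => htube s (hsub hs)) hupto t₁
      (right_mem_Icc.2 ht₁.1)
    have hexp : Real.exp (-(β / 2) * (t₁ - t₀)) ≤ 1 := by
      rw [Real.exp_le_one_iff]
      nlinarith [ht₁.1]
    have hz := (htube t₁ ht₁ (y t₁) (hy.constraint t₁ ht₁.1) hat).2
    have hfst : ‖(y t₁ - x t₁).1‖ ≤ C ^ 2 * κ ^ 2 * ‖y t₀ - x t₀‖ :=
      calc _ ≤ C * (κ ^ 2 * 1 * (C * ‖y t₀ - x t₀‖)) := by
            refine (hC _).2.trans (mul_le_mul_of_nonneg_left (hdec.trans ?_) hC0)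
            gcongr
            exact (hC _).1.trans (mul_le_mul_of_nonneg_left (norm_fst_le _) hC0)
        _ = _ := by ring
    have hall : ‖y t₁ - x t₁‖ ≤ (1 + L) * ‖(y t₁ - x t₁).1‖ := by
      have h1 := norm_nonneg (y t₁ - x t₁).1
      have h2 := mul_nonneg hL h1
      rw [Prod.norm_def]
      exact max_le (by linarith) (by linarith)
    have : (1 + L) * ‖(y t₁ - x t₁).1‖ ≤ (1 + L) * (C ^ 2 * κ ^ 2 * ‖y t₀ - x t₀‖) :=
      mul_le_mul_of_nonneg_left hfst (by linarith)
    linarith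
  intro t ht
  exact ⟨(hstay t ht).le, norm_sub_le_exp_of_mem_tube hg hC hC1 hκ hη hηβ hx hy hpt htube
    (fun s hs => (hstay s hs).le) t ht⟩

/-! ### Local exponential stability -/

/-- The error `η` of the linearization must leave half of the contraction rate `β`, after the
weights `M`, `M⁻¹` and two changes of norm. -/
theorem exists_linearization_error {κ C β : ℝ} (hκ : 1 ≤ κ) (hC : 1 ≤ C) (hβ : 0 < β) :
    ∃ η : ℝ, 0 < η ∧ κ ^ 2 * C ^ 2 * η ≤ β / 2 := by
  have h1 : 0 < κ := zero_lt_one.trans_le hκ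
  have h2 : 0 < C := zero_lt_one.trans_le hC
  exact ⟨β / 2 / (κ ^ 2 * C ^ 2), by positivity, by field_simp; rfl⟩

/-- The reference solution is the equilibrium, for which a single tube serves for all times. -/
theorem locallyExpStable_of_isContractionPoint (p : ℝ≥0∞) [Fact (1 ≤ p)] {q : ℝ≥0∞}
    [Fact (1 ≤ q)] {f : State n m → Fin n → ℝ} {g : State n m → Fin m → ℝ}
    {M : State n m → Matrix (Fin n) (Fin n) ℝ} {β κ : ℝ} (hf : ContDiff ℝ 1 f)
    (hg : ContDiff ℝ 1 g) (hf0 : f 0 = 0) (hg0 : g 0 = 0) (hβ : 0 < β) (hκ : 1 ≤ κ)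
    (h0 : IsContractionPoint q f g M β κ 0) : LocallyExpStable p f g := by
  obtain ⟨C, hC1, hC⟩ := exists_norm_toLp_equiv q (Fin n)
  obtain ⟨D, hD1, hD⟩ := exists_pnorm_equiv p n m
  obtain ⟨η, hη, hηβ⟩ := exists_linearization_error hκ hC1 hβ
  obtain ⟨r, L, hr, hL, htube⟩ := exists_hasTube_of_isCompact hf hg
    (isCompact_singleton (x := (0 : State n m))) (by simpa using h0.isUnit_partialZ)
    (by simpa using hg0) hη
  have hC0 : 0 < C := zero_lt_one.trans_le hC1
  have hD0 : 0 < D := zero_lt_one.trans_le hD1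
  have hκ0 : 0 < κ := zero_lt_one.trans_le hκ
  have hL0 : 0 < 1 + L := by linarith
  refine ⟨r / ((1 + L) * C ^ 2 * κ ^ 2 * D), by positivity,
    D ^ 2 * (1 + L) * C ^ 2 * κ ^ 2, by positivity, β / 2, half_pos hβ, ?_⟩
  intro t₀ y hy hstart t ht
  have hstart' : pnorm p (y t₀) < r / ((1 + L) * C ^ 2 * κ ^ 2 * D) := hstart
  rw [lt_div_iff₀ (by positivity)] at hstart'
  have key := mem_tube_and_norm_sub_le_exp (T := t) (r := r) hg hC hC1 hκ hη.le hηβ hβ.le hL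
    (isSolution_zero hf0 hg0 t₀) hy (fun _ _ => h0) (fun _ _ => htube 0 rfl) (by
      rw [sub_zero]
      have := mul_le_mul_of_nonneg_left (hD (y t₀)).2
        (by positivity : 0 ≤ (1 + L) * C ^ 2 * κ ^ 2)
      linarith) t ⟨ht, le_rfl⟩
  obtain ⟨hmem, hdec⟩ := key
  have hz := (htube 0 rfl (y t) (hy.constraint t ht) hmem).2
  rw [sub_zero] at hz hdec
  rw [sub_zero] at hdec
  have hall : ‖y t‖ ≤ (1 + L) * ‖(y t).1‖ := by
    have h1 := norm_nonneg (y t).1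
    have h2 := mul_nonneg hL h1
    rw [Prod.norm_def]
    exact max_le (by linarith) (by linarith)
  calc pnorm p (y t) ≤ D * ((1 + L) * (C * (κ ^ 2 * Real.exp (-(β / 2) * (t - t₀)) *
          (C * (D * pnorm p (y t₀)))))) := by
        refine (hD _).1.trans (mul_le_mul_of_nonneg_left (hall.trans ?_) hD0.le)
        refine mul_le_mul_of_nonneg_left ((hC _).2.trans ?_) hL0.le
        refine mul_le_mul_of_nonneg_left (hdec.trans ?_) hC0.le
        gcongr
        refine (hC _).1.trans (mul_le_mul_of_nonneg_left ?_ hC0.le)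
        exact (norm_fst_le _).trans (hD _).2
    _ = _ := by ring

/-! ### Global contraction -/

/-- A reference solution in the contraction region controls all solutions that start near it, on
each bounded time interval. -/
theorem exists_norm_sub_le_exp {q : ℝ≥0∞} [Fact (1 ≤ q)] {f : State n m → Fin n → ℝ}
    {g : State n m → Fin m → ℝ} {M : State n m → Matrix (Fin n) (Fin n) ℝ} {β κ : ℝ}
    (hf : ContDiff ℝ 1 f) (hg : ContDiff ℝ 1 g) (hβ : 0 < β) (hκ : 1 ≤ κ) {t₀ T : ℝ}
    {x : ℝ → State n m} (hx : IsSolution f g t₀ x)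
    (hpt : ∀ t ∈ Icc t₀ T, IsContractionPoint q f g M β κ (x t)) :
    ∃ δ L : ℝ, 0 < δ ∧ ∀ y, IsSolution f g t₀ y → ‖y t₀ - x t₀‖ < δ → ∀ t ∈ Icc t₀ T,
      ‖(WithLp.toLp q (y t - x t).1 : PiLp q fun _ : Fin n => ℝ)‖ ≤
        κ ^ 2 * Real.exp (-(β / 2) * (t - t₀)) *
          ‖(WithLp.toLp q (y t₀ - x t₀).1 : PiLp q fun _ : Fin n => ℝ)‖ ∧
      ‖(y t - x t).2‖ ≤ L * ‖(y t - x t).1‖ := by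
  obtain ⟨C, hC1, hC⟩ := exists_norm_toLp_equiv q (Fin n)
  obtain ⟨η, hη, hηβ⟩ := exists_linearization_error hκ hC1 hβ
  obtain ⟨r, L, hr, hL, htube⟩ := exists_hasTube_of_isCompact hf hg
    (isCompact_Icc.image_of_continuousOn
      (hx.continuousOn.mono (Icc_subset_Ici_self : Icc t₀ T ⊆ Ici t₀)))
    (forall_mem_image.2 fun t ht => (hpt t ht).isUnit_partialZ)
    (forall_mem_image.2 fun t ht => hx.constraint t ht.1) hη
  have hC0 : 0 < C := zero_lt_one.trans_le hC1
  have hκ0 : 0 < κ := zero_lt_one.trans_le hκ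
  refine ⟨r / ((1 + L) * C ^ 2 * κ ^ 2), L, by positivity, fun y hy hstart t ht => ?_⟩
  rw [lt_div_iff₀ (by positivity), mul_comm] at hstart
  have key := mem_tube_and_norm_sub_le_exp hg hC hC1 hκ hη.le hηβ hβ.le hL hx hy hpt
    (fun t ht => htube _ (mem_image_of_mem x ht)) hstart t ht
  exact ⟨key.2, (htube _ (mem_image_of_mem x ht) (y t) (hy.constraint t ht.1) key.1).2⟩

/-- Solutions in the contraction region are determined by their initial value. -/
theorem IsSolution.eq_of_isContractionPoint {q : ℝ≥0∞} [Fact (1 ≤ q)]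
    {f : State n m → Fin n → ℝ} {g : State n m → Fin m → ℝ}
    {M : State n m → Matrix (Fin n) (Fin n) ℝ} {β κ : ℝ}
    (hf : ContDiff ℝ 1 f) (hg : ContDiff ℝ 1 g) (hβ : 0 < β) (hκ : 1 ≤ κ) {t₀ : ℝ}
    {x y : ℝ → State n m} (hx : IsSolution f g t₀ x) (hy : IsSolution f g t₀ y)
    (hpt : ∀ t, t₀ ≤ t → IsContractionPoint q f g M β κ (x t)) (hxy : y t₀ = x t₀) {t : ℝ}
    (ht : t₀ ≤ t) : y t = x t := by
  obtain ⟨δ, L, hδ, h⟩ := exists_norm_sub_le_exp (T := t) hf hg hβ hκ hx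
    (fun s hs => hpt s hs.1)
  obtain ⟨h1, h2⟩ := h y hy (by simpa [hxy] using hδ) t ⟨ht, le_rfl⟩
  have h3 : (y t - x t).1 = 0 := by
    rw [hxy, sub_self, Prod.fst_zero, WithLp.toLp_zero, norm_zero, mul_zero, norm_le_zero_iff,
      WithLp.toLp_eq_zero] at h1
    exact h1
  have h4 : (y t - x t).2 = 0 := by
    rwa [h3, norm_zero, mul_zero, norm_le_zero_iff] at h2
  exact sub_eq_zero.1 (Prod.ext h3 h4)

/-- A continuous solution `z₀` of the constraint is Lipschitz along segments, since its difference
quotients approach `-[∂g/∂z]⁻¹ ∂g/∂w`. -/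
theorem norm_sub_le_of_constraint {g : State n m → Fin m → ℝ} (hg : ContDiff ℝ 1 g)
    {W : Set (Fin n → ℝ)} (hW : Convex ℝ W) {z₀ : (Fin n → ℝ) → Fin m → ℝ}
    (hz₀ : ContinuousOn z₀ W) (hgz : ∀ w ∈ W, g (w, z₀ w) = 0)
    (hunit : ∀ w ∈ W, IsUnit (partialZ g (w, z₀ w))) {K : ℝ}
    (hK : ∀ w ∈ W, ∀ v, ‖algSlope g (w, z₀ w) *ᵥ v‖ ≤ K * ‖v‖) {w₁ w₂ : Fin n → ℝ}
    (hw₁ : w₁ ∈ W) (hw₂ : w₂ ∈ W) : ‖z₀ w₂ - z₀ w₁‖ ≤ (1 + K) * ‖w₂ - w₁‖ := by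
  have hmaps : MapsTo (AffineMap.lineMap w₁ w₂ : ℝ → Fin n → ℝ) (Icc 0 1) W := fun s hs =>
    hW.segment_subset hw₁ hw₂ (by
      rw [segment_eq_image_lineMap]
      exact mem_image_of_mem _ hs)
  have hline : Continuous (AffineMap.lineMap w₁ w₂ : ℝ → Fin n → ℝ) :=
    AffineMap.lineMap_continuous
  have h := norm_sub_le_of_eventually_lipschitz
    (F := fun s : ℝ => z₀ (AffineMap.lineMap w₁ w₂ s)) (c := (1 + K) * ‖w₂ - w₁‖) ?_
  · simpa using h
  intro s hs
  set x₀ : State n m := (AffineMap.lineMap w₁ w₂ s, z₀ (AffineMap.lineMap w₁ w₂ s)) with hx₀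
  have htend : Tendsto (fun s' : ℝ => ((x₀, (AffineMap.lineMap w₁ w₂ s',
      z₀ (AffineMap.lineMap w₁ w₂ s'))) : State n m × State n m)) (𝓝[Icc 0 1] s)
      (𝓝 (x₀, x₀)) :=
    tendsto_const_nhds.prodMk_nhds ((hline.continuousWithinAt).prodMk_nhds
      ((hz₀.comp hline.continuousOn hmaps) s hs))
  filter_upwards [htend.eventually (eventually_norm_snd_add_le hg (hunit _ (hmaps hs)) one_pos),
    self_mem_nhdsWithin] with s' h1 hs'
  specialize h1 (hgz _ (hmaps hs)) (hgz _ (hmaps hs'))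
  have h2 := hK _ (hmaps hs) ((AffineMap.lineMap w₁ w₂ s' : Fin n → ℝ) - AffineMap.lineMap w₁ w₂ s)
  simp only [hx₀, Prod.fst_sub, Prod.snd_sub, one_mul] at h1
  have h3 := norm_sub_le_of_le h1 h2
  rw [add_sub_cancel_right] at h3
  have h4 : ‖(AffineMap.lineMap w₁ w₂ s' : Fin n → ℝ) - AffineMap.lineMap w₁ w₂ s‖ =
      ‖w₂ - w₁‖ * |s' - s| := by
    rw [← dist_eq_norm, dist_lineMap_lineMap, Real.dist_eq, dist_comm, dist_eq_norm, mul_comm]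
  rw [h4] at h3
  linarith

/-- The initial values are joined by the graph of `z₀` over a segment, and the solutions that start
on this curve carry the local decay estimate from one end to the other. -/
theorem contractingOn_of_isContractionPoint (p : ℝ≥0∞) [Fact (1 ≤ p)] {q : ℝ≥0∞}
    [Fact (1 ≤ q)] {f : State n m → Fin n → ℝ} {g : State n m → Fin m → ℝ}
    {M : State n m → Matrix (Fin n) (Fin n) ℝ} {β κ K : ℝ} (hf : ContDiff ℝ 1 f)
    (hg : ContDiff ℝ 1 g) (hβ : 0 < β) (hκ : 1 ≤ κ) {W : Set (Fin n → ℝ)} {Z : Set (Fin m → ℝ)}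
    (hWZ : EvolvesWithin f g (W ×ˢ Z)) (hW : Convex ℝ W) (hsolv : UniquelySolvable g W Z)
    (hslope : ∀ x ∈ W ×ˢ Z, inducedNorm p (algSlope g x) ≤ K)
    (hpt : ∀ x ∈ consistentSet g (W ×ˢ Z), IsContractionPoint q f g M β κ x) :
    ContractingOn p f g (W ×ˢ Z) := by
  obtain ⟨z₀, hz₀, hz₀u⟩ := hsolv
  obtain ⟨C, hC1, hC⟩ := exists_norm_toLp_equiv q (Fin n)
  obtain ⟨D, hD1, hD⟩ := exists_pnorm_equiv p n m
  obtain ⟨Cn, hCn1, hCn⟩ := exists_norm_toLp_equiv p (Fin n)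
  obtain ⟨Cm, hCm1, hCm⟩ := exists_norm_toLp_equiv p (Fin m)
  have hC0 : 0 < C := zero_lt_one.trans_le hC1
  have hD0 : 0 < D := zero_lt_one.trans_le hD1
  have hκ0 : 0 < κ := zero_lt_one.trans_le hκ
  have hCn0 : 0 < Cn := zero_lt_one.trans_le hCn1
  have hCm0 : 0 < Cm := zero_lt_one.trans_le hCm1
  have hgraph : ∀ w ∈ W, (w, z₀ w) ∈ consistentSet g (W ×ˢ Z) := fun w hw =>
    ⟨⟨hw, ((hz₀u w hw _).2 rfl).1⟩, ((hz₀u w hw _).2 rfl).2⟩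
  have hsnd : ∀ x ∈ consistentSet g (W ×ˢ Z), x.2 = z₀ x.1 := fun x hx =>
    (hz₀u x.1 hx.1.1 x.2).1 ⟨hx.1.2, hx.2⟩
  set K' : ℝ := Cm * max K 0 * Cn with hK'
  have hK'0 : 0 ≤ K' := by positivity
  have hslope' : ∀ w ∈ W, ∀ v, ‖algSlope g (w, z₀ w) *ᵥ v‖ ≤ K' * ‖v‖ := by
    intro w hw v
    calc _ ≤ Cm * (max K 0 * (Cn * ‖v‖)) := by
          refine (hCm _).2.trans (mul_le_mul_of_nonneg_left ?_ hCm0.le)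
          refine (norm_toLp_mulVec_le p _ v).trans ?_
          gcongr
          · exact (hslope _ (hgraph w hw).1).trans (le_max_left _ _)
          · exact (hCn v).1
      _ = _ := by ring
  have hlip : ∀ w₁ ∈ W, ∀ w₂ ∈ W, ‖z₀ w₂ - z₀ w₁‖ ≤ (1 + K') * ‖w₂ - w₁‖ := fun w₁ h₁ w₂ h₂ =>
    norm_sub_le_of_constraint hg hW hz₀ (fun w hw => (hgraph w hw).2)
      (fun w hw => (hpt _ (hgraph w hw)).isUnit_partialZ) hslope' h₁ h₂
  refine ⟨D ^ 2 * (1 + K') * C ^ 2 * κ ^ 2, by positivity, β / 2, half_pos hβ, ?_⟩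
  intro t₀ x₁ x₂ hx₁ hx₂ hx₁S hx₂S t ht
  have hc₁ : x₁ t₀ ∈ consistentSet g (W ×ˢ Z) := ⟨hx₁S, hx₁.constraint t₀ self_mem_Ici⟩
  have hc₂ : x₂ t₀ ∈ consistentSet g (W ×ˢ Z) := ⟨hx₂S, hx₂.constraint t₀ self_mem_Ici⟩
  set γ : ℝ → Fin n → ℝ := ⇑(AffineMap.lineMap (k := ℝ) (x₁ t₀).1 (x₂ t₀).1) with hγ
  have hmaps : MapsTo γ (Icc 0 1) W := fun s hs =>
    hW.segment_subset hx₁S.1 hx₂S.1 (by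
      rw [segment_eq_image_lineMap]
      exact mem_image_of_mem _ hs)
  have hline : Continuous γ := AffineMap.lineMap_continuous
  -- the solutions that start on the curve above the segment of initial values
  have hex : ∀ s : ℝ, ∃ X : ℝ → State n m, s ∈ Icc (0 : ℝ) 1 →
      IsSolution f g t₀ X ∧ X t₀ = (γ s, z₀ (γ s)) ∧
        ∀ τ, t₀ ≤ τ → X τ ∈ consistentSet g (W ×ˢ Z) := by
    intro s
    by_cases hs : s ∈ Icc (0 : ℝ) 1
    · obtain ⟨X, hX, hX0, hXS⟩ := hWZ _ (hgraph _ (hmaps hs))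
      have hX' := hX.comp_add t₀
      exact ⟨_, fun _ => ⟨hX', by simpa using hX0, fun τ hτ =>
        ⟨hXS _ (sub_nonneg.2 hτ), hX'.constraint τ hτ⟩⟩⟩
    · exact ⟨fun _ => 0, fun h => absurd h hs⟩
  choose X hX using hex
  have hstart : ∀ s ∈ Icc (0 : ℝ) 1, Tendsto (fun s' => X s' t₀) (𝓝[Icc 0 1] s)
      (𝓝 (X s t₀)) := by
    intro s hs
    rw [(hX s hs).2.1]
    refine Tendsto.congr' (f₁ := fun s' => (γ s', z₀ (γ s'))) ?_
      (hline.continuousWithinAt.prodMk_nhds ((hz₀.comp hline.continuousOn hmaps) s hs))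
    filter_upwards [self_mem_nhdsWithin] with s' hs'
    exact (hX s' hs').2.1.symm
  set E := κ ^ 2 * Real.exp (-(β / 2) * (t - t₀)) with hE
  have hw : ‖(WithLp.toLp q (X 1 t).1 : PiLp q fun _ : Fin n => ℝ) - WithLp.toLp q (X 0 t).1‖ ≤
      E * ‖(WithLp.toLp q (x₂ t₀ - x₁ t₀).1 : PiLp q fun _ : Fin n => ℝ)‖ := by
    refine norm_sub_le_of_eventually_lipschitz
      (F := fun s => (WithLp.toLp q (X s t).1 : PiLp q fun _ : Fin n => ℝ)) fun s hs => ?_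
    obtain ⟨δ, L, hδ, h⟩ := exists_norm_sub_le_exp (T := t) hf hg hβ hκ (hX s hs).1
      (fun τ hτ => hpt _ ((hX s hs).2.2 τ hτ.1))
    have hnear := Metric.tendsto_nhds.1 (hstart s hs) δ hδ
    filter_upwards [hnear, self_mem_nhdsWithin] with s' hs' hs'I
    rw [dist_eq_norm] at hs'
    have h1 := (h _ (hX s' hs'I).1 hs' t ⟨ht, le_rfl⟩).1
    have h2 : (X s' t₀ - X s t₀).1 = (s' - s) • (x₂ t₀ - x₁ t₀).1 := by
      rw [(hX s hs).2.1, (hX s' hs'I).2.1]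
      simp only [hγ, AffineMap.lineMap_apply_module', Prod.fst_sub]
      module
    rw [h2, WithLp.toLp_smul, norm_smul, Real.norm_eq_abs, Prod.fst_sub, WithLp.toLp_sub] at h1
    refine h1.trans (le_of_eq ?_)
    ring
  have heq : ∀ (s : ℝ) (x : ℝ → State n m), s ∈ Icc (0 : ℝ) 1 → IsSolution f g t₀ x →
      x t₀ ∈ consistentSet g (W ×ˢ Z) → γ s = (x t₀).1 → x t = X s t := by
    intro s x hs hx hxc hγs
    refine (hX s hs).1.eq_of_isContractionPoint hf hg hβ hκ hx
      (fun τ hτ => hpt _ ((hX s hs).2.2 τ hτ)) ?_ ht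
    rw [(hX s hs).2.1, hγs]
    exact Prod.ext rfl (hsnd _ hxc)
  have e₁ : x₁ t = X 0 t := heq 0 x₁ (by simp) hx₁ hc₁ (by simp [hγ])
  have e₂ : x₂ t = X 1 t := heq 1 x₂ (by simp) hx₂ hc₂ (by simp [hγ])
  have hc₁t : x₁ t ∈ consistentSet g (W ×ˢ Z) := e₁ ▸ (hX 0 (by simp)).2.2 t ht
  have hc₂t : x₂ t ∈ consistentSet g (W ×ˢ Z) := e₂ ▸ (hX 1 (by simp)).2.2 t ht
  rw [← e₁, ← e₂, ← norm_neg, neg_sub, ← WithLp.toLp_sub, ← Prod.fst_sub] at hw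
  have hnorm0 : ‖(WithLp.toLp q (x₂ t₀ - x₁ t₀).1 : PiLp q fun _ : Fin n => ℝ)‖ ≤
      C * ‖x₁ t₀ - x₂ t₀‖ := by
    refine (hC _).1.trans (mul_le_mul_of_nonneg_left ?_ hC0.le)
    rw [norm_sub_rev (x₁ t₀)]
    exact norm_fst_le _
  have hz : ‖(x₁ t - x₂ t).2‖ ≤ (1 + K') * ‖(x₁ t - x₂ t).1‖ := by
    rw [Prod.snd_sub, Prod.fst_sub, hsnd _ hc₁t, hsnd _ hc₂t]
    exact hlip _ hc₂t.1.1 _ hc₁t.1.1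
  have hall : ‖x₁ t - x₂ t‖ ≤ (1 + K') * ‖(x₁ t - x₂ t).1‖ := by
    rw [Prod.norm_def]
    exact max_le (le_mul_of_one_le_left (norm_nonneg _) (by linarith)) hz
  calc pnorm p (x₁ t - x₂ t)
      ≤ D * ((1 + K') * (C * (E * (C * (D * pnorm p (x₁ t₀ - x₂ t₀)))))) := by
        refine (hD _).1.trans (mul_le_mul_of_nonneg_left (hall.trans ?_) hD0.le)
        refine mul_le_mul_of_nonneg_left ((hC _).2.trans ?_) (by linarith)
        refine mul_le_mul_of_nonneg_left (hw.trans ?_) hC0.le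
        refine mul_le_mul_of_nonneg_left (hnorm0.trans ?_) (by positivity)
        exact mul_le_mul_of_nonneg_left (hD _).2 hC0.le
    _ = _ := by
        rw [hE]
        ring

theorem ContractingOn.expStableOn {p : ℝ≥0∞} [Fact (1 ≤ p)] {f : State n m → Fin n → ℝ}
    {g : State n m → Fin m → ℝ} {S : Set (State n m)} (h : ContractingOn p f g S)
    (hf0 : f 0 = 0) (hg0 : g 0 = 0) (h0 : (0 : State n m) ∈ S) : ExpStableOn p f g S := by
  obtain ⟨c, hc, α, hα, h⟩ := h
  refine ⟨c, hc, α, hα, fun t₀ x hx hxS t ht => ?_⟩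
  simpa only [sub_zero] using h t₀ x _ hx (isSolution_zero hf0 hg0 t₀) hxS h0 t ht

end DAE

theorem corollary1 {n m : ℕ} (p q : ENNReal) [Fact (1 ≤ p)] [Fact (1 ≤ q)]
    (f : DAE.State n m → Fin n → ℝ) (g : DAE.State n m → Fin m → ℝ)
    (hf : ContDiff ℝ 1 f) (hg : ContDiff ℝ 2 g)
    -- the origin is an equilibrium
    (hf0 : f 0 = 0) (hg0 : g 0 = 0)
    -- the region, which contains the origin and within which the system evolves
    (W : Set (Fin n → ℝ)) (Z : Set (Fin m → ℝ)) (h0 : (0 : DAE.State n m) ∈ W ×ˢ Z)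
    (hWZ : DAE.EvolvesWithin f g (W ×ˢ Z))
    -- index 1, and boundedness of `[∂g/∂z]⁻¹ ∂g/∂w`, on the region
    (hindex : ∀ x ∈ W ×ˢ Z, IsUnit (DAE.partialZ g x))
    (hslope : ∃ K : ℝ, ∀ x ∈ W ×ˢ Z, DAE.inducedNorm p (DAE.algSlope g x) ≤ K)
    -- the matrix `M(w, z)` and the matrix measure condition
    (M : DAE.State n m → Matrix (Fin n) (Fin n) ℝ)
    (hMdiff : ∀ x ∈ DAE.consistentSet g (W ×ˢ Z), ∀ i j, DifferentiableAt ℝ (fun y => M y i j) x)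
    (hMinv : ∀ x ∈ DAE.consistentSet g (W ×ˢ Z), IsUnit (M x))
    (β : ℝ) (hβ : 0 < β)
    (hμ : ∀ x ∈ DAE.consistentSet g (W ×ˢ Z), DAE.matrixMeasure q (DAE.JM f g M x) ≤ -β) :
    DAE.LocallyExpStable p f g ∧
      (Convex ℝ W → DAE.UniquelySolvable g W Z →
        (∃ κ : ℝ, ∀ x ∈ DAE.consistentSet g (W ×ˢ Z),
          DAE.inducedNorm q (M x) ≤ κ ∧ DAE.inducedNorm q (M x)⁻¹ ≤ κ) →
        DAE.ContractingOn p f g (W ×ˢ Z) ∧ DAE.ExpStableOn p f g (W ×ˢ Z)) := by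
  have hg1 : ContDiff ℝ 1 g := hg.of_le one_le_two
  have hpt : ∀ κ : ℝ, ∀ x ∈ DAE.consistentSet g (W ×ˢ Z), DAE.inducedNorm q (M x) ≤ κ →
      DAE.inducedNorm q (M x)⁻¹ ≤ κ → DAE.IsContractionPoint q f g M β κ x :=
    fun κ x hx h1 h2 => ⟨hindex x hx.1, hMdiff x hx, hMinv x hx, hμ x hx, h1, h2⟩
  refine ⟨?_, ?_⟩
  · exact DAE.locallyExpStable_of_isContractionPoint p hf hg1 hf0 hg0 hβ (le_max_left 1 _)
      (hpt _ 0 ⟨h0, hg0⟩ ((le_max_left _ _).trans (le_max_right 1 _))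
        ((le_max_right (DAE.inducedNorm q (M 0)) _).trans (le_max_right 1 _)))
  · rintro hW hsolv ⟨κ, hκ⟩
    obtain ⟨K, hK⟩ := hslope
    have hcontr : DAE.ContractingOn p f g (W ×ˢ Z) :=
      DAE.contractingOn_of_isContractionPoint p hf hg1 hβ (le_max_left 1 κ) hWZ hW hsolv hK
        fun x hx => hpt _ x hx ((hκ x hx).1.trans (le_max_right _ _))
          ((hκ x hx).2.trans (le_max_right _ _))
    exact ⟨hcontr, hcontr.expStableOn hf0 hg0 h0⟩
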